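/- **Theorem 5.1.** For all $\gamma>0$ and $\theta>1$ there is $\varepsilon>0$, depending only on $\gamma$ and $\theta$, such that the following holds. Let $\mathcal X$ be a reflexive real Banach space, $\mathcal Y$ a real Hilbert space, and $\Theta:\mathcal X\to(-\infty,\infty]$ a proper, lower semi-continuous, $2$-convex function: there is $C_0>0$ with $\Theta(\lambda z+(1-\lambda)x)+C_0\lambda(1-\lambda)\|z-x\|^2\le\lambda\Theta(z)+(1-\lambda)\Theta(x)$ for all $x,z\in\mathcal X$, $\lambda\in(0,1)$. For $\xi\in\partial\Theta(x)$ (subdifferential) let $D_\xi\Theta(z,x):=\Theta(z)-\Theta(x)-\langle\xi,z-x\rangle$, and assume $\|z-x\|\le\gamma\,[D_\xi\Theta(z,x)]^{1/2}$ for all $z,x\in\mathcal X$ and $\xi\in\partial\Theta(x)$. Let $\alpha_n>0$ satisfy $1\le\alpha_n/\alpha_{n+1}\le\theta$ for all $n\ge0$ and $\alpha_n\to0$. Let $D(F)\subset\mathcal X$ be closed and convex, $F:D(F)\to\mathcal Y$, $y\in\mathcal Y$, and $x^\dagger\in D(F)$ with $F(x^\dagger)=y$ and $\partial\Theta(x^\dagger)\ne\emptyset$.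 Let $\rho>0$, $B_\rho(x^\dagger)=\{x:\|x-x^\dagger\|<\rho\}$, and for each $x\in B_\rho(x^\dagger)\cap D(F)$ let $F'(x):\mathcal X\to\mathcal Y$ be a bounded linear operator with $$\lim_{t\searrow0}\frac{F(x+t(z-x))-F(x)}{t}=F'(x)(z-x)\qquad\text{for all } z\in B_\rho(x^\dagger)\cap D(F).$$ Put $T:=F'(x^\dagger)$ and assume $\|T\|\le\sqrt{\alpha_0}/\gamma$. Let $K_0,K_1\ge0$ be such that, for all $w\in\mathcal X$ and $x,z\in B_\rho(x^\dagger)\cap D(F)$, $$\|[F'(z)-F'(x)]w\|\le K_0\|z-x\|\,\|F'(x)w\|+K_1\|F'(x)(z-x)\|\,\|w\|.$$ Let $\Theta_F:=\Theta$ on $D(F)$ and $\Theta_F:=+\infty$ elsewhere, and let $\Theta_F^*(\xi)=\sup_x\{\langle\xi,x\rangle-\Theta_F(x)\}$ be its Fenchel conjugate. Let $\xi_0\in\mathcal X^*$, and let $\xi^\dagger\in\partial\Theta_F(x^\dagger)$ realize the distance from $\xi_0$ to $\partial\Theta_F(x^\dagger)$, that is, $\|\xi_0-\xi^\dagger\|=d(\xi_0,\partial\Theta_F(x^\dagger))$.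 Assume that $\langle\xi_0-\xi^\dagger,x\rangle=0$ for all $x$ with $Tx=0$, that $2\gamma^2\|\xi_0-\xi^\dagger\|<\rho$, and that $(K_0+K_1)\|\xi_0-\xi^\dagger\|\le\varepsilon$. Then the noise-free iteration $x_0:=\nabla\Theta_F^*(\xi_0)$, $$x_{n+1}:=\text{the unique minimizer over } x\in\mathcal X \text{ of } \|y-F(x_n)-F'(x_n)(x-x_n)\|^2+\alpha_nD_{\xi_0}\Theta_F(x,x_0),$$ is well defined, that is, there is exactly one sequence $(x_n)_{n\ge0}$ satisfying these rules; moreover $x_n\in B_\rho(x^\dagger)\cap D(F)$ for all $n$, and $$\lim_{n\to\infty}\|x_n-x^\dagger\|=0\qquad\text{and}\qquad\lim_{n\to\infty}\frac{\|T(x_n-x^\dagger)\|}{\sqrt{\alpha_n}}=0.$$ -/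

import Mathlib

open Filter Topology

universe u v

namespace IRGN

noncomputable section

/-- A real normed space is reflexive when the canonical embedding into its topological bidual is
surjective. -/
def Reflexive (X : Type u) [NormedAddCommGroup X] [NormedSpace ℝ X] : Prop :=
  Function.Surjective (NormedSpace.inclusionInDoubleDual ℝ X)

section Convex

variable {X : Type u} [NormedAddCommGroup X] [NormedSpace ℝ X]

/-- `Θ` takes values in `(-∞, ∞]` and is finite somewhere. -/
def Proper (Θ : X → EReal) : Prop :=
  (∀ x, Θ x ≠ ⊥) ∧ ∃ x, Θ x ≠ ⊤

/-- `Θ` is `2`-convex: there is `C₀ > 0` with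
`Θ (λ z + (1 - λ) x) + C₀ λ (1 - λ) ‖z - x‖² ≤ λ Θ z + (1 - λ) Θ x` for all `x`, `z`, `0 < λ < 1`. -/
def TwoConvex (Θ : X → EReal) : Prop :=
  ∃ C₀ : ℝ, 0 < C₀ ∧ ∀ (x z : X) (l : ℝ), 0 < l → l < 1 →
    Θ (l • z + (1 - l) • x) + ((C₀ * l * (1 - l) * ‖z - x‖ ^ 2 : ℝ) : EReal)
      ≤ (l : EReal) * Θ z + ((1 - l : ℝ) : EReal) * Θ x

/-- The subdifferential `∂Θ(x)`, a subset of the dual space; it is empty where `Θ x = ∞`. -/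
def subdiff (Θ : X → EReal) (x : X) : Set (StrongDual ℝ X) :=
  {ξ | Θ x ≠ ⊤ ∧ ∀ z, Θ x + ((ξ (z - x) : ℝ) : EReal) ≤ Θ z}

/-- The Bregman distance `D_ξ Θ(z, x) = Θ(z) - Θ(x) - ⟨ξ, z - x⟩`, possibly `∞`. -/
def bregman (Θ : X → EReal) (ξ : StrongDual ℝ X) (z x : X) : EReal :=
  Θ z - Θ x - ((ξ (z - x) : ℝ) : EReal)

/-- `‖z - x‖ ≤ γ (D_ξ Θ(z, x))^(1/2)` for all `z`, all `x` and all `ξ ∈ ∂Θ(x)`, written in squared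
form. -/
def BregmanBound (Θ : X → EReal) (γ : ℝ) : Prop :=
  ∀ (z x : X), ∀ ξ ∈ subdiff Θ x,
    ((‖z - x‖ ^ 2 : ℝ) : EReal) ≤ ((γ ^ 2 : ℝ) : EReal) * bregman Θ ξ z x

open Classical in
/-- The function that is `0` on `D` and `∞` off `D`. -/
def charFn (D : Set X) (x : X) : EReal := if x ∈ D then 0 else ⊤

/-- `Θ_F = Θ + χ_D`, where `D` is the domain of the forward operator `F`. -/
def restricted (Θ : X → EReal) (D : Set X) (x : X) : EReal := Θ x + charFn D x

/-- The Fenchel conjugate `f*(ξ) = sup_x (⟨ξ, x⟩ - f(x))`. -/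
def conj (f : X → EReal) (ξ : StrongDual ℝ X) : EReal :=
  ⨆ x, ((ξ x : ℝ) : EReal) - f x

/-- `x = ∇f*(ξ)`: the conjugate `f*` is finite near `ξ` and Fréchet differentiable at `ξ`, with
derivative the evaluation at `x`. -/
def IsConjGradient (f : X → EReal) (ξ : StrongDual ℝ X) (x : X) : Prop :=
  (∀ᶠ η in 𝓝 ξ, conj f η ≠ ⊤ ∧ conj f η ≠ ⊥) ∧
    HasFDerivAt (fun η => (conj f η).toReal) (NormedSpace.inclusionInDoubleDual ℝ X x) ξ

/-- `x` is the unique minimizer of `J` over the whole space. -/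
def IsUniqueMinimizer (J : X → EReal) (x : X) : Prop :=
  ∀ z, z ≠ x → J x < J z

/-- The annihilator `N(T)^⊥` in the dual space of the null space of `T`. -/
def nullAnnihilator {Y : Type v} [NormedAddCommGroup Y] [NormedSpace ℝ Y]
    (T : X →L[ℝ] Y) : Set (StrongDual ℝ X) :=
  {ξ | ∀ x, T x = 0 → ξ x = 0}

end Convex

/-- `α_n > 0`, `1 ≤ α_n / α_{n+1} ≤ θ` and `α_n → 0`. -/
structure StepSizes (α : ℕ → ℝ) (θ : ℝ) : Prop where
  pos : ∀ n, 0 < α n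
  one_le : ∀ n, 1 ≤ α n / α (n + 1)
  le_theta : ∀ n, α n / α (n + 1) ≤ θ
  tendsto_zero : Tendsto α atTop (𝓝 0)

section Method

variable {X : Type u} [NormedAddCommGroup X] [NormedSpace ℝ X]
variable {Y : Type v} [NormedAddCommGroup Y] [NormedSpace ℝ Y]

/-- The conditions on the forward operator `F : D → Y` (only its values on `D` are used), on the
solution `xd` of `F x = y`, and on the operators `F' x` (only those with
`x ∈ B_ρ(xd) ∩ D` are used); `α₀` is the first step size. -/
structure OperatorCondition (Θ : X → EReal) (γ : ℝ) (D : Set X) (F : X → Y) (F' : X → X →L[ℝ] Y)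
    (y : Y) (xd : X) (ρ K₀ K₁ α₀ : ℝ) : Prop where
  closed : IsClosed D
  convex : Convex ℝ D
  sol_mem : xd ∈ D
  sol_eq : F xd = y
  sol_subdiff : (subdiff Θ xd).Nonempty
  rho_pos : 0 < ρ
  deriv : ∀ x ∈ Metric.ball xd ρ ∩ D, ∀ z ∈ Metric.ball xd ρ ∩ D,
    Tendsto (fun t : ℝ => t⁻¹ • (F (x + t • (z - x)) - F x)) (𝓝[>] 0) (𝓝 (F' x (z - x)))
  scaled : ‖F' xd‖ ≤ Real.sqrt α₀ / γ
  K₀_nonneg : 0 ≤ K₀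
  K₁_nonneg : 0 ≤ K₁
  nonlinearity : ∀ x ∈ Metric.ball xd ρ ∩ D, ∀ z ∈ Metric.ball xd ρ ∩ D, ∀ w : X,
    ‖(F' z - F' x) w‖ ≤ K₀ * ‖z - x‖ * ‖F' x w‖ + K₁ * ‖F' x (z - x)‖ * ‖w‖

/-- The functional `x ↦ ‖y - F(xₙ) - F'(xₙ)(x - xₙ)‖² + a D_{ξ₀} Φ(x, x₀)` minimized in one step. -/
def stepFunctional (Φ : X → EReal) (F : X → Y) (F' : X → X →L[ℝ] Y) (y : Y)
    (ξ₀ : StrongDual ℝ X) (x₀ xn : X) (a : ℝ) (x : X) : EReal :=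
  ((‖y - F xn - F' xn (x - xn)‖ ^ 2 : ℝ) : EReal) + (a : EReal) * bregman Φ ξ₀ x x₀

/-- `x` is the noise-free iteration started from `ξ₀`: `x₀ = ∇Θ_F*(ξ₀)`, and `x_{n+1}` is the
unique minimizer of the step functional at `x_n`. -/
structure IsNoiseFreeIteration (Θ : X → EReal) (D : Set X) (F : X → Y) (F' : X → X →L[ℝ] Y)
    (y : Y) (α : ℕ → ℝ) (ξ₀ : StrongDual ℝ X) (x : ℕ → X) : Prop where
  init : IsConjGradient (restricted Θ D) ξ₀ (x 0)
  step : ∀ n, IsUniqueMinimizer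
    (stepFunctional (restricted Θ D) F F' y ξ₀ (x 0) (x n) (α n)) (x (n + 1))

end Method

end

end IRGN

/-! Write `e n = x n - xd`, `v = ξ₀ - ξd`, `T = F' xd`. The Bregman bound concerns subgradients of
`Θ` only, whereas `ξd` is a subgradient of the restriction to `D`.
`UniformConvexOn.of_subgradient_growth` therefore turns the bound into uniform convexity with
constant `γ⁻²`, which does pass to `D`. It yields existence, uniqueness and quadratic growth of all
minimizers involved, by completeness alone.

Comparing `x (n + 1)` with `xd` in the step functional bounds `γ⁻² ‖e (n + 1)‖²` and the linearized
residual by the residual at `xd` and `v (e (n + 1))`. The nonlinearity condition makes the residual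
at `xd` a small multiple of `‖T (e n)‖`, so the errors stay bounded and `‖T (e n)‖ = O(√α n)`
(`step_bounds`, `iterate_bounds`).

Hence `T (e n) → 0`. By reflexivity `v` is a norm limit of functionals `⟨w, T ·⟩`, so `v (e n) → 0`.
Fed back into the step estimates, this gives both limits (`iterate_tendsto`). -/

theorem isClosed_sublevel_add_continuous {E : Type*} [TopologicalSpace E] {S : Set E}
    {g q : E → ℝ} (hcl : ∀ M, IsClosed {x | x ∈ S ∧ g x ≤ M})
    (hq : Continuous q) (M : ℝ) : IsClosed {x | x ∈ S ∧ g x + q x ≤ M} := by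
  rw [isClosed_iff_frequently]
  intro x hx
  have key : ∀ δ > 0, x ∈ S ∧ g x ≤ M - q x + δ := fun δ hδ =>
    isClosed_iff_frequently.1 (hcl (M - q x + δ)) x
      ((hx.and_eventually (hq.continuousAt.eventually (lt_mem_nhds (sub_lt_self (q x) hδ)))).mono
        fun y hy => ⟨hy.1.1, by linarith [hy.1.2, hy.2]⟩)
  refine ⟨(key 1 one_pos).1, ?_⟩
  have : g x ≤ M - q x := le_of_forall_pos_le_add fun δ hδ => (key δ hδ).2
  linarith

/-! ### Minimizers and subgradients of quadratically uniformly convex functions. -/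

section UniformConvexity

variable {E : Type*} [NormedAddCommGroup E] [NormedSpace ℝ E] {S : Set E} {g q : E → ℝ} {c : ℝ}

/-- A quadratically uniformly convex function with closed sublevel sets is bounded below. -/
theorem UniformConvexOn.exists_lower_bound (hc : 0 < c)
    (hg : UniformConvexOn S (fun r => c * r ^ 2) g)
    (hcl : ∀ M, IsClosed {x | x ∈ S ∧ g x ≤ M}) : ∃ m, ∀ x ∈ S, m ≤ g x := by
  rcases S.eq_empty_or_nonempty with rfl | ⟨x₀, hx₀⟩
  · exact ⟨0, by simp⟩
  have hopen := (hcl (g x₀ - 1)).isOpen_compl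
  obtain ⟨r, hr, hball⟩ := Metric.isOpen_iff.1 hopen x₀ (by simp)
  have hball' : ∀ x ∈ S, dist x x₀ < r → g x₀ - 1 < g x := fun x hx hd => by
    by_contra! h
    exact hball (Metric.mem_ball.2 hd) ⟨hx, h⟩
  refine ⟨g x₀ - 1 - 2 / (c * r ^ 2), fun z hz => ?_⟩
  have hpos : 0 < 2 / (c * r ^ 2) := by positivity
  by_cases hd : dist z x₀ < r
  · linarith [hball' z hz hd]
  push Not at hd
  rw [dist_eq_norm] at hd
  set d := ‖z - x₀‖ with hd'
  have hd0 : 0 < d := hr.trans_le hd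
  -- This `l` puts the convex combination at distance `r / 2` from `x₀`, inside the ball where `g >
  -- g x₀ - 1`.
  set l := r / (2 * d) with hl
  have hl0 : 0 < l := by positivity
  have hld : l * d = r / 2 := by rw [hl]; field_simp
  have hl1 : l ≤ 1 / 2 := by rw [hl, div_le_iff₀ (by positivity)]; linarith
  have hw : l • z + (1 - l) • x₀ ∈ S := hg.1 hz hx₀ hl0.le (by linarith) (by ring)
  have h1 : g x₀ - 1 < g (l • z + (1 - l) • x₀) := by
    apply hball' _ hw
    have : l • z + (1 - l) • x₀ - x₀ = l • (z - x₀) := by module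
    rw [dist_eq_norm, this, norm_smul, Real.norm_of_nonneg hl0.le, hld]
    linarith
  have h2 := hg.2 hz hx₀ hl0.le (show (0 : ℝ) ≤ 1 - l by linarith) (by ring)
  simp only [smul_eq_mul, ← hd'] at h2
  have h3 : l * (g z - g x₀) ≥ -1 + l * c * d ^ 2 / 2 := by
    have : l * (1 - l) * (c * d ^ 2) ≥ l * (1 / 2) * (c * d ^ 2) := by gcongr; linarith
    linarith
  -- The constant `2 / (c r²)` is the one for which the difference becomes a perfect square.
  have h4 : l * (-(2 / (c * r ^ 2))) ≤ -1 + l * c * d ^ 2 / 2 := by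
    have e1 : d = r / (2 * l) := by field_simp; linarith
    have : -1 + l * c * d ^ 2 / 2 - l * (-(2 / (c * r ^ 2)))
        = (c * r ^ 2 - 4 * l) ^ 2 / (8 * l * (c * r ^ 2)) := by
      rw [e1]; field_simp; ring
    have h0 : 0 ≤ (c * r ^ 2 - 4 * l) ^ 2 / (8 * l * (c * r ^ 2)) := by positivity
    linarith
  have h5 := le_of_mul_le_mul_left (h4.trans h3) hl0
  linarith

/-- At a minimizer, a quadratically uniformly convex function grows quadratically. -/
theorem UniformConvexOn.quadratic_growth (hg : UniformConvexOn S (fun r => c * r ^ 2) g)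
    {x : E} (hx : x ∈ S) (hmin : ∀ z ∈ S, g x ≤ g z) {z : E} (hz : z ∈ S) :
    g x + c * ‖z - x‖ ^ 2 ≤ g z := by
  -- Convexity between `x` and `z`, divided by `l`; then `l → 0`.
  have key : ∀ l ∈ Set.Ioo (0 : ℝ) 1, g x + (1 - l) * (c * ‖z - x‖ ^ 2) ≤ g z := by
    rintro l ⟨h0, h1⟩
    have h2 := hg.2 hz hx h0.le (show (0 : ℝ) ≤ 1 - l by linarith) (by ring)
    have h3 := hmin _ (hg.1 hz hx h0.le (show (0 : ℝ) ≤ 1 - l by linarith) (by ring))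
    simp only [smul_eq_mul] at h2
    refine le_of_mul_le_mul_left ?_ h0
    nlinarith
  have ht : Tendsto (fun l : ℝ => g x + (1 - l) * (c * ‖z - x‖ ^ 2)) (𝓝[>] 0)
      (𝓝 (g x + (1 - 0) * (c * ‖z - x‖ ^ 2))) :=
    (Continuous.tendsto (by fun_prop) 0).mono_left nhdsWithin_le_nhds
  have := le_of_tendsto ht (by
    filter_upwards [Ioo_mem_nhdsGT (zero_lt_one' ℝ)] with l hl using key l hl)
  simpa using this

/-- On a complete space, a quadratically uniformly convex function with closed sublevel sets attains
its minimum. -/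
theorem UniformConvexOn.exists_forall_growth_le [CompleteSpace E] (hc : 0 < c)
    (hg : UniformConvexOn S (fun r => c * r ^ 2) g) (hne : S.Nonempty)
    (hcl : ∀ M, IsClosed {x | x ∈ S ∧ g x ≤ M}) :
    ∃ x ∈ S, ∀ z ∈ S, g x + c * ‖z - x‖ ^ 2 ≤ g z := by
  obtain ⟨m₀, hm₀⟩ := hg.exists_lower_bound hc hcl
  set m := sInf (g '' S) with hm
  have hbdd : BddBelow (g '' S) := ⟨m₀, by rintro _ ⟨x, hx, rfl⟩; exact hm₀ x hx⟩
  have hmle : ∀ x ∈ S, m ≤ g x := fun x hx => csInf_le hbdd ⟨x, hx, rfl⟩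
  have hex : ∀ n : ℕ, ∃ x ∈ S, g x ≤ m + 1 / ((n : ℝ) + 1) := fun n => by
    obtain ⟨_, ⟨x, hx, rfl⟩, hlt⟩ := exists_lt_of_csInf_lt (hne.image g)
      (show sInf (g '' S) < m + 1 / ((n : ℝ) + 1) from
        lt_add_of_pos_right m Nat.one_div_pos_of_nat)
    exact ⟨x, hx, hlt.le⟩
  choose u hu hgu using hex
  have hmono : ∀ {N n : ℕ}, N ≤ n → g (u n) ≤ m + 1 / ((N : ℝ) + 1) := fun h =>
    (hgu _).trans (by gcongr)
  -- Midpoints have value at least `m`, so `c/4 ‖u i - u j‖²` is at most the excess of the two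
  -- values over `m`.
  have hcauchy : CauchySeq u := by
    refine cauchySeq_of_le_tendsto_0 (fun N : ℕ => √(4 / c * (1 / ((N : ℝ) + 1)))) ?_ ?_
    · intro i j N hi hj
      have h1 := hg.2 (hu i) (hu j) (show (0 : ℝ) ≤ 1 / 2 by norm_num)
        (show (0 : ℝ) ≤ 1 / 2 by norm_num) (by norm_num)
      have h2 := hmle _ (hg.1 (hu i) (hu j) (show (0 : ℝ) ≤ 1 / 2 by norm_num)
        (show (0 : ℝ) ≤ 1 / 2 by norm_num) (by norm_num))
      simp only [smul_eq_mul] at h1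
      rw [dist_eq_norm]
      apply Real.le_sqrt_of_sq_le
      rw [div_mul_eq_mul_div, le_div_iff₀ hc]
      linarith [hmono hi, hmono hj]
    · have h := ((tendsto_one_div_add_atTop_nhds_zero_nat (𝕜 := ℝ)).const_mul (4 / c)).sqrt
      simpa using h
  obtain ⟨x, hx⟩ := cauchySeq_tendsto_of_complete hcauchy
  have hmem : ∀ N : ℕ, x ∈ S ∧ g x ≤ m + 1 / ((N : ℝ) + 1) := fun N =>
    (hcl (m + 1 / ((N : ℝ) + 1))).mem_of_tendsto hx
      (by filter_upwards [eventually_ge_atTop N] with n hn using ⟨hu n, hmono hn⟩)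
  have hxS := (hmem 0).1
  have hxm : g x ≤ m := by
    have ht := (tendsto_one_div_add_atTop_nhds_zero_nat (𝕜 := ℝ)).const_add m
    rw [add_zero] at ht
    exact ge_of_tendsto' ht fun N => (hmem N).2
  exact ⟨x, hxS, fun z hz => hg.quadratic_growth hxS (fun z hz => hxm.trans (hmle z hz)) hz⟩

theorem UniformConvexOn.add_convexOn {φ : ℝ → ℝ} (hg : UniformConvexOn S φ g)
    (hq : ConvexOn ℝ S q) : UniformConvexOn S φ (fun x => g x + q x) := by
  simpa using! hg.add hq.uniformConvexOn_zero

/-- The sum rule of subdifferential calculus at a minimizer of the sum, one summand being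
continuous. -/
theorem ConvexOn.exists_subgradient_of_isMinOn_add (hg : ConvexOn ℝ S g)
    (hq : ConvexOn ℝ Set.univ q) (hqc : Continuous q) {x : E} (hx : x ∈ S)
    (hmin : ∀ z ∈ S, g x + q x ≤ g z + q z) :
    ∃ ξ : StrongDual ℝ E, (∀ z ∈ S, g x + ξ (z - x) ≤ g z) ∧ ∀ z, q x - ξ (z - x) ≤ q z := by
  have hA : Convex ℝ {p : E × ℝ | q p.1 - q x < p.2} := by
    have := (hq.add_const (-q x)).convex_strict_epigraph
    simpa [sub_eq_add_neg] using this
  have hAo : IsOpen {p : E × ℝ | q p.1 - q x < p.2} :=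
    isOpen_lt (by fun_prop) (by fun_prop)
  have hB : Convex ℝ {p : E × ℝ | p.1 ∈ S ∧ p.2 ≤ g x - g p.1} := by
    have := (hg.neg.add_const (g x)).convex_hypograph
    convert this using 4
    simp [sub_eq_add_neg, add_comm]
  have hdis : Disjoint {p : E × ℝ | q p.1 - q x < p.2} {p : E × ℝ | p.1 ∈ S ∧ p.2 ≤ g x - g p.1} := by
    rw [Set.disjoint_left]
    rintro ⟨z, t⟩ h1 ⟨h2, h3⟩
    have := hmin z h2
    simp only [Set.mem_ofPred_eq] at h1 h3
    linarith
  obtain ⟨f, s, hf1, hf2⟩ := geometric_hahn_banach_open hA hAo hB hdis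
  set β := f (0, 1) with hβ
  set φ : StrongDual ℝ E := f.comp (ContinuousLinearMap.inl ℝ E ℝ) with hφ
  have hf : ∀ z t, f (z, t) = φ z + β * t := fun z t => by
    have : ((z, t) : E × ℝ) = (z, 0) + t • (0, 1) := by simp
    rw [this, map_add, map_smul]
    simp [hφ, hβ, mul_comm]
  have hA' : ∀ z t, q z - q x < t → φ z + β * t < s := fun z t h => by
    rw [← hf]; exact hf1 (z, t) h
  have hB' : ∀ z ∈ S, ∀ t ≤ g x - g z, s ≤ φ z + β * t := fun z hz t h => by
    rw [← hf]; exact hf2 (z, t) ⟨hz, h⟩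
  have hsx : s ≤ φ x := by simpa using hB' x hx 0 (by simp)
  -- The separating hyperplane is not vertical, because `(x, 1)` lies in the open epigraph.
  have hβ0 : β < 0 := by
    have := hA' x 1 (by simp)
    linarith
  have hA'' : ∀ z, φ z + β * (q z - q x) ≤ s := fun z => by
    have ht : Tendsto (fun t : ℝ => φ z + β * t) (𝓝[>] (q z - q x)) (𝓝 (φ z + β * (q z - q x))) :=
      (Continuous.tendsto (by fun_prop) _).mono_left nhdsWithin_le_nhds
    exact le_of_tendsto ht (by
      filter_upwards [self_mem_nhdsWithin] with t ht using (hA' z t ht).le)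
  have hxs : φ x ≤ s := by simpa using hA'' x
  refine ⟨β⁻¹ • φ, fun z hz => ?_, fun z => ?_⟩
  · have h := hB' z hz _ le_rfl
    have h2 : β⁻¹ * (φ z - φ x) ≤ g z - g x := by
      rw [inv_mul_eq_div, div_le_iff_of_neg hβ0]
      linarith
    simp only [_root_.smul_apply, map_sub, smul_eq_mul, mul_sub] at h2 ⊢
    linarith
  · have h := hA'' z
    have h2 : -(q z - q x) ≤ β⁻¹ * (φ z - φ x) := by
      rw [inv_mul_eq_div, le_div_iff_of_neg hβ0]
      linarith
    simp only [_root_.smul_apply, map_sub, smul_eq_mul, mul_sub] at h2 ⊢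
    linarith

theorem convexOn_mul_norm_sub_sq {k : ℝ} (hk : 0 ≤ k) (w : E) :
    ConvexOn ℝ Set.univ fun z : E => k * ‖z - w‖ ^ 2 := by
  have h1 : ConvexOn ℝ Set.univ fun z : E => ‖z - w‖ := by
    have := (convexOn_univ_norm (E := E)).translate_left (-w)
    simpa [Function.comp_def, sub_eq_add_neg] using this
  have := (h1.pow (fun _ _ => norm_nonneg _) 2).smul hk
  simpa [Pi.pow_def] using this

/-- If all subgradient inequalities of a quadratically uniformly convex function hold with a
quadratic gain of constant `c'`, then so does the convexity inequality. -/
theorem UniformConvexOn.of_subgradient_growth [CompleteSpace E] {c' : ℝ} (hc : 0 < c) (hc' : 0 ≤ c')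
    (hg : UniformConvexOn S (fun r => c * r ^ 2) g) (hcl : ∀ M, IsClosed {x | x ∈ S ∧ g x ≤ M})
    (hsub : ∀ x ∈ S, ∀ ξ : StrongDual ℝ E, (∀ z ∈ S, g x + ξ (z - x) ≤ g z) →
      ∀ z ∈ S, g x + ξ (z - x) + c' * ‖z - x‖ ^ 2 ≤ g z) :
    UniformConvexOn S (fun r => c' * r ^ 2) g := by
  refine ⟨hg.1, fun x hx z hz a b ha hb hab => ?_⟩
  set w := a • x + b • z with hw
  have hwS : w ∈ S := hg.1 hx hz ha hb hab
  set R := a • g x + b • g z - a * b * (c' * ‖x - z‖ ^ 2) with hR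
  have hgc : ConvexOn ℝ S g := hg.convexOn fun r => by positivity
  -- `g` may have no subgradient at `w`. The proximal point `u`, minimizing `g + k ‖· - w‖²`, has
  -- one by the sum rule.
  have key : ∀ k : ℝ, 0 < k → ∃ u ∈ S, g u ≤ R ∧ g u + k * ‖u - w‖ ^ 2 ≤ g w := by
    intro k hk
    have hq := convexOn_mul_norm_sub_sq hk.le w
    have hqc : Continuous fun z : E => k * ‖z - w‖ ^ 2 := by fun_prop
    obtain ⟨u, huS, hu⟩ := (hg.add_convexOn (hq.subset (Set.subset_univ _) hg.1)).exists_forall_growth_le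
      hc ⟨x, hx⟩ (isClosed_sublevel_add_continuous hcl hqc)
    have humin : ∀ z ∈ S, g u + k * ‖u - w‖ ^ 2 ≤ g z + k * ‖z - w‖ ^ 2 := fun z hz =>
      (le_add_of_nonneg_right (by positivity)).trans (hu z hz)
    obtain ⟨ξ, hξ, hξq⟩ := hgc.exists_subgradient_of_isMinOn_add hq hqc huS humin
    refine ⟨u, huS, ?_, by simpa using humin w hwS⟩
    have h1 := hsub u huS ξ hξ x hx
    have h2 := hsub u huS ξ hξ z hz
    have h3 := hξq w
    -- This sign lets the linear term be dropped when the inequalities at `x` and `z` are averaged.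
    have h4 : 0 ≤ ξ (w - u) := by
      have : 0 ≤ k * ‖u - w‖ ^ 2 := by positivity
      simp only [sub_self, norm_zero] at h3
      nlinarith
    have h5 : ξ (w - u) = a * ξ (x - u) + b * ξ (z - u) := by
      have : w - u = a • (x - u) + b • (z - u) := by
        rw [hw]
        have : u = (a + b) • u := by rw [hab, one_smul]
        nth_rw 1 [this]
        module
      rw [this]; simp
    have h6 : ‖x - z‖ ≤ ‖x - u‖ + ‖z - u‖ := by
      have := norm_sub_le (x - u) (z - u)
      simpa using this
    have h7 : a * b * ‖x - z‖ ^ 2 ≤ a * ‖x - u‖ ^ 2 + b * ‖z - u‖ ^ 2 := by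
      calc a * b * ‖x - z‖ ^ 2 ≤ a * b * (‖x - u‖ + ‖z - u‖) ^ 2 := by gcongr
        _ ≤ a * ‖x - u‖ ^ 2 + b * ‖z - u‖ ^ 2 := by
          obtain rfl : b = 1 - a := by linarith
          nlinarith [sq_nonneg (a * ‖x - u‖ - (1 - a) * ‖z - u‖)]
    have h8 := mul_le_mul_of_nonneg_left h7 hc'
    have h9 := mul_le_mul_of_nonneg_left h1 ha
    have h10 := mul_le_mul_of_nonneg_left h2 hb
    have h11 : a * g u + b * g u = g u := by rw [← add_mul, hab, one_mul]
    rw [hR, smul_eq_mul, smul_eq_mul]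
    nlinarith
  obtain ⟨m, hm⟩ := hg.exists_lower_bound hc hcl
  choose! u huS huR huw using key
  -- As `k → ∞` the proximal points tend to `w`, since `g` is bounded below; the bound `R` survives
  -- by closedness.
  have hlim : Tendsto (fun n : ℕ => u ((n : ℝ) + 1)) atTop (𝓝 w) := by
    rw [tendsto_iff_norm_sub_tendsto_zero]
    have ht : Tendsto (fun n : ℕ => √((g w - m) * (1 / ((n : ℝ) + 1)))) atTop (𝓝 0) := by
      simpa using ((tendsto_one_div_add_atTop_nhds_zero_nat (𝕜 := ℝ)).const_mul (g w - m)).sqrt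
    refine squeeze_zero (fun _ => norm_nonneg _) (fun n => ?_) ht
    have hn : (0 : ℝ) < (n : ℝ) + 1 := by positivity
    apply Real.le_sqrt_of_sq_le
    rw [mul_one_div, le_div_iff₀ hn]
    linarith [huw _ hn, hm _ (huS _ hn)]
  exact ((hcl R).mem_of_tendsto hlim (Eventually.of_forall fun n =>
    ⟨huS _ (by positivity), huR _ (by positivity)⟩)).2

end UniformConvexity

/-! ### Extended-real functionals reduced to their finite parts. -/

namespace IRGN

variable {X : Type*}

/-- The extended real function `Φ` is finite exactly on `S`, where it agrees with `g`. -/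
structure FinitePart (Φ : X → EReal) (S : Set X) (g : X → ℝ) : Prop where
  coe : ∀ x ∈ S, Φ x = (g x : EReal)
  top : ∀ x ∉ S, Φ x = ⊤

theorem IsUniqueMinimizer.unique {J : X → EReal} {x x' : X} (hx : IsUniqueMinimizer J x)
    (hx' : IsUniqueMinimizer J x') : x = x' := by
  by_contra hne
  exact lt_asymm (hx x' (Ne.symm hne)) (hx' x hne)

namespace FinitePart

variable {Φ : X → EReal} {S : Set X} {g : X → ℝ}

theorem of_ne_bot (h : ∀ x, Φ x ≠ ⊥) :
    FinitePart Φ {x | Φ x ≠ ⊤} (fun x => (Φ x).toReal) where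
  coe x hx := (EReal.coe_toReal hx (h x)).symm
  top x hx := by simpa using hx

theorem restricted (h : FinitePart Φ S g) (D : Set X) : FinitePart (restricted Φ D) (S ∩ D) g where
  coe x hx := by simp [IRGN.restricted, charFn, hx.2, h.coe x hx.1]
  top x hx := by
    by_cases hD : x ∈ D
    · have hS : x ∉ S := fun hS => hx ⟨hS, hD⟩
      simp [IRGN.restricted, charFn, hD, h.top x hS]
    · by_cases hS : x ∈ S
      · simp [IRGN.restricted, charFn, hD, h.coe x hS]
      · simp [IRGN.restricted, charFn, hD, h.top x hS]

theorem ne_top_iff (h : FinitePart Φ S g) {x : X} : Φ x ≠ ⊤ ↔ x ∈ S := by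
  by_cases hx : x ∈ S
  · simp [h.coe x hx, hx]
  · simp [h.top x hx, hx]

theorem isClosed_sublevel [TopologicalSpace X] (h : FinitePart Φ S g) (hΦ : LowerSemicontinuous Φ) (M : ℝ) :
    IsClosed {x | x ∈ S ∧ g x ≤ M} := by
  convert hΦ.isClosed_preimage (M : EReal) using 1
  ext x
  by_cases hx : x ∈ S
  · simp [h.coe x hx, hx]
  · simp [h.top x hx, hx]

variable [NormedAddCommGroup X] [NormedSpace ℝ X]
  {Y : Type*} [NormedAddCommGroup Y] [NormedSpace ℝ Y]

theorem mem_subdiff_iff (h : FinitePart Φ S g) {x : X} {ξ : StrongDual ℝ X} :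
    ξ ∈ subdiff Φ x ↔ x ∈ S ∧ ∀ z ∈ S, g x + ξ (z - x) ≤ g z := by
  simp only [subdiff, Set.mem_ofPred_eq, h.ne_top_iff]
  refine and_congr_right fun hx => ⟨fun H z hz => ?_, fun H z => ?_⟩
  · have := H z
    rw [h.coe x hx, h.coe z hz] at this
    exact_mod_cast this
  · by_cases hz : z ∈ S
    · rw [h.coe x hx, h.coe z hz]
      exact_mod_cast H z hz
    · rw [h.top z hz]
      exact le_top

theorem bregman_eq (h : FinitePart Φ S g) {x z : X} (hx : x ∈ S) (hz : z ∈ S)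
    (ξ : StrongDual ℝ X) : bregman Φ ξ z x = ((g z - g x - ξ (z - x) : ℝ) : EReal) := by
  rw [bregman, h.coe x hx, h.coe z hz]
  norm_cast

theorem bregman_eq_top (h : FinitePart Φ S g) {x z : X} (hx : x ∈ S) (hz : z ∉ S)
    (ξ : StrongDual ℝ X) : bregman Φ ξ z x = ⊤ := by
  rw [bregman, h.coe x hx, h.top z hz, EReal.top_sub_coe, EReal.top_sub_coe]

theorem uniformConvexOn (h : FinitePart Φ S g) (hΦ : TwoConvex Φ) :
    ∃ c : ℝ, 0 < c ∧ UniformConvexOn S (fun r => c * r ^ 2) g := by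
  obtain ⟨c, hc, H⟩ := hΦ
  have key : ∀ x ∈ S, ∀ z ∈ S, ∀ l : ℝ, 0 < l → l < 1 → l • z + (1 - l) • x ∈ S ∧
      g (l • z + (1 - l) • x) + c * l * (1 - l) * ‖z - x‖ ^ 2 ≤ l * g z + (1 - l) * g x := by
    intro x hx z hz l h0 h1
    have H' := H x z l h0 h1
    rw [h.coe x hx, h.coe z hz] at H'
    have hw : l • z + (1 - l) • x ∈ S := by
      by_contra hw
      rw [h.top _ hw, EReal.top_add_coe, top_le_iff] at H'
      exact EReal.coe_ne_top (l * g z + (1 - l) * g x) (by exact_mod_cast H')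
    rw [h.coe _ hw] at H'
    exact ⟨hw, by exact_mod_cast H'⟩
  refine ⟨c, hc, fun x hx z hz a b ha hb hab => ?_, fun x hx z hz a b ha hb hab => ?_⟩
  all_goals
    obtain rfl : b = 1 - a := by linarith
    rcases ha.eq_or_lt with rfl | ha
    · simp [hz]
    rcases hb.eq_or_lt with hb | hb
    · obtain rfl : a = 1 := by linarith
      simp [hx]
    have := key z hz x hx a ha (by linarith)
  · exact this.1
  · simp only [smul_eq_mul]
    linarith [this.2]

theorem subgradient_growth (h : FinitePart Φ S g) {γ : ℝ} (hγ : 0 < γ) (hΦ : BregmanBound Φ γ) :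
    ∀ x ∈ S, ∀ ξ : StrongDual ℝ X, (∀ z ∈ S, g x + ξ (z - x) ≤ g z) →
      ∀ z ∈ S, g x + ξ (z - x) + (γ ^ 2)⁻¹ * ‖z - x‖ ^ 2 ≤ g z := by
  intro x hx ξ hξ z hz
  have H := hΦ z x ξ (h.mem_subdiff_iff.2 ⟨hx, hξ⟩)
  rw [h.bregman_eq hx hz] at H
  have H' : ‖z - x‖ ^ 2 ≤ γ ^ 2 * (g z - g x - ξ (z - x)) := by exact_mod_cast H
  have := (inv_mul_le_iff₀ (by positivity : 0 < γ ^ 2)).2 H'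
  linarith

variable {c : ℝ} {ξ₀ : StrongDual ℝ X} {x₀ : X}

/-- If `g - ξ₀` grows quadratically away from `x₀`, then `x₀` is the gradient of the conjugate
function at `ξ₀`. -/
theorem isConjGradient (h : FinitePart Φ S g) (hc : 0 < c) (hx₀ : x₀ ∈ S)
    (hgr : ∀ z ∈ S, g x₀ + ξ₀ (z - x₀) + c * ‖z - x₀‖ ^ 2 ≤ g z) : IsConjGradient Φ ξ₀ x₀ := by
  have lower : ∀ η : StrongDual ℝ X, ((η x₀ - g x₀ : ℝ) : EReal) ≤ conj Φ η := fun η => by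
    refine le_trans (le_of_eq ?_) (le_iSup (fun x => ((η x : ℝ) : EReal) - Φ x) x₀)
    rw [h.coe x₀ hx₀]
    norm_cast
  -- By Young's inequality the conjugate lies between an affine function and that function plus a
  -- multiple of `‖η - ξ₀‖²`, which forces differentiability at `ξ₀`.
  have upper : ∀ η : StrongDual ℝ X,
      conj Φ η ≤ ((η x₀ - g x₀ + (4 * c)⁻¹ * ‖η - ξ₀‖ ^ 2 : ℝ) : EReal) := fun η => by
    refine iSup_le fun z => ?_
    by_cases hz : z ∈ S
    · rw [h.coe z hz]
      have h1 := hgr z hz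
      have h2 : (η - ξ₀) (z - x₀) ≤ ‖η - ξ₀‖ * ‖z - x₀‖ :=
        (le_abs_self _).trans ((η - ξ₀).le_opNorm _)
      have h3 : ‖η - ξ₀‖ * ‖z - x₀‖ ≤ c * ‖z - x₀‖ ^ 2 + (4 * c)⁻¹ * ‖η - ξ₀‖ ^ 2 := by
        have : c * ‖z - x₀‖ ^ 2 + (4 * c)⁻¹ * ‖η - ξ₀‖ ^ 2 - ‖η - ξ₀‖ * ‖z - x₀‖
            = (2 * c * ‖z - x₀‖ - ‖η - ξ₀‖) ^ 2 / (4 * c) := by field_simp; ring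
        have h0 : 0 ≤ (2 * c * ‖z - x₀‖ - ‖η - ξ₀‖) ^ 2 / (4 * c) := by positivity
        linarith
      have h4 : η z - g z ≤ η x₀ - g x₀ + (4 * c)⁻¹ * ‖η - ξ₀‖ ^ 2 := by
        simp only [_root_.sub_apply, map_sub] at h1 h2
        linarith
      exact_mod_cast h4
    · rw [h.top z hz, EReal.sub_top]
      exact bot_le
  have hfin : ∀ η : StrongDual ℝ X, conj Φ η ≠ ⊤ ∧ conj Φ η ≠ ⊥ := fun η =>
    ⟨((upper η).trans_lt (EReal.coe_lt_top _)).ne, ((EReal.bot_lt_coe _).trans_le (lower η)).ne'⟩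
  have lowerR : ∀ η, η x₀ - g x₀ ≤ (conj Φ η).toReal := fun η => by
    rw [← EReal.coe_le_coe_iff, EReal.coe_toReal (hfin η).1 (hfin η).2]
    exact lower η
  have upperR : ∀ η, (conj Φ η).toReal ≤ η x₀ - g x₀ + (4 * c)⁻¹ * ‖η - ξ₀‖ ^ 2 := fun η => by
    rw [← EReal.coe_le_coe_iff, EReal.coe_toReal (hfin η).1 (hfin η).2]
    exact upper η
  refine ⟨Eventually.of_forall hfin, ?_⟩
  have hval : (conj Φ ξ₀).toReal = ξ₀ x₀ - g x₀ :=
    le_antisymm (by simpa using upperR ξ₀) (lowerR ξ₀)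
  rw [hasFDerivAt_iff_isLittleO]
  refine Asymptotics.IsBigO.trans_isLittleO (g := fun η => ‖η - ξ₀‖ ^ 2)
    (Asymptotics.IsBigO.of_bound (4 * c)⁻¹ (Eventually.of_forall fun η => ?_)) ?_
  · have h1 := lowerR η
    have h2 := upperR η
    rw [hval, NormedSpace.dual_def, _root_.sub_apply, Real.norm_eq_abs, abs_of_nonneg (by linarith),
      Real.norm_of_nonneg (by positivity)]
    linarith
  · have : Tendsto (fun η : StrongDual ℝ X => η - ξ₀) (𝓝 ξ₀) (𝓝 0) := by
      simpa using! (continuous_id.sub continuous_const).tendsto (f := fun η => η - ξ₀) ξ₀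
    have h2 := (Asymptotics.isLittleO_norm_pow_id (E' := StrongDual ℝ X) one_lt_two).comp_tendsto this
    exact h2

variable {F : X → Y} {F' : X → X →L[ℝ] Y} {y : Y} {xn : X} {a : ℝ}

theorem stepFunctional_eq (h : FinitePart Φ S g) (hx₀ : x₀ ∈ S) {z : X} (hz : z ∈ S) :
    stepFunctional Φ F F' y ξ₀ x₀ xn a z
      = ((‖y - F xn - F' xn (z - xn)‖ ^ 2 + a * (g z - g x₀ - ξ₀ (z - x₀)) : ℝ) : EReal) := by
  rw [stepFunctional, h.bregman_eq hx₀ hz]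
  norm_cast

theorem stepFunctional_eq_top (h : FinitePart Φ S g) (ha : 0 < a) (hx₀ : x₀ ∈ S) {z : X}
    (hz : z ∉ S) : stepFunctional Φ F F' y ξ₀ x₀ xn a z = ⊤ := by
  rw [stepFunctional, h.bregman_eq_top hx₀ hz, EReal.coe_mul_top_of_pos ha, EReal.coe_add_top]

/-- Divided by `a` and up to a constant, the functional is `g` plus a continuous convex `q`;
quadratic growth makes the minimizer strict. -/
theorem exists_isUniqueMinimizer [CompleteSpace X] (h : FinitePart Φ S g) (hc : 0 < c)
    (hg : UniformConvexOn S (fun r => c * r ^ 2) g) (hcl : ∀ M, IsClosed {x | x ∈ S ∧ g x ≤ M})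
    (ha : 0 < a) (hx₀ : x₀ ∈ S) :
    ∃ x, IsUniqueMinimizer (stepFunctional Φ F F' y ξ₀ x₀ xn a) x := by
  set q : X → ℝ := fun z => a⁻¹ * ‖F' xn z - (y - F xn + F' xn xn)‖ ^ 2 + -ξ₀ z with hq
  have hqc : Continuous q := by fun_prop
  have hqconv : ConvexOn ℝ Set.univ q := by
    have h1 := (convexOn_mul_norm_sub_sq (inv_nonneg.2 ha.le)
      (y - F xn + F' xn xn)).comp_linearMap (F' xn : X →ₗ[ℝ] Y)
    exact h1.add (((-ξ₀ : StrongDual ℝ X) : X →ₗ[ℝ] ℝ).convexOn convex_univ)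
  obtain ⟨x, hxS, hx⟩ := (hg.add_convexOn (hqconv.subset (Set.subset_univ _)
    hg.1)).exists_forall_growth_le hc ⟨x₀, hx₀⟩ (isClosed_sublevel_add_continuous hcl hqc)
  refine ⟨x, fun z hzx => ?_⟩
  rw [h.stepFunctional_eq hx₀ hxS]
  by_cases hz : z ∈ S
  · rw [h.stepFunctional_eq hx₀ hz, EReal.coe_lt_coe_iff]
    have hpos : 0 < c * ‖z - x‖ ^ 2 := by
      have := norm_pos_iff.2 (sub_ne_zero.2 hzx)
      positivity
    have h1 : g x + q x < g z + q z := by linarith [hx z hz]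
    have h2 := mul_lt_mul_of_pos_left h1 ha
    have e : ∀ u, a * (g u + q u) = ‖y - F xn - F' xn (u - xn)‖ ^ 2 + a * (g u - ξ₀ u) := by
      intro u
      have : y - F xn - F' xn (u - xn) = -(F' xn u - (y - F xn + F' xn xn)) := by
        rw [map_sub]; abel
      rw [hq, this, norm_neg]
      field_simp
      ring
    rw [e, e] at h2
    simp only [map_sub]
    simp only [map_sub] at h2
    linarith
  · rw [h.stepFunctional_eq_top ha hx₀ hz]
    exact EReal.coe_lt_top _

theorem mem_of_isUniqueMinimizer (h : FinitePart Φ S g) (ha : 0 < a) (hx₀ : x₀ ∈ S) {x : X}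
    (hx : IsUniqueMinimizer (stepFunctional Φ F F' y ξ₀ x₀ xn a) x) : x ∈ S := by
  by_contra hxS
  have := hx x₀ fun e => hxS (e ▸ hx₀)
  rw [h.stepFunctional_eq_top ha hx₀ hxS] at this
  exact not_top_lt this

theorem le_of_isUniqueMinimizer (h : FinitePart Φ S g) (ha : 0 < a) (hx₀ : x₀ ∈ S) {x : X}
    (hx : IsUniqueMinimizer (stepFunctional Φ F F' y ξ₀ x₀ xn a) x) {z : X} (hz : z ∈ S) :
    ‖y - F xn - F' xn (x - xn)‖ ^ 2 + a * (g x - g x₀ - ξ₀ (x - x₀))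
      ≤ ‖y - F xn - F' xn (z - xn)‖ ^ 2 + a * (g z - g x₀ - ξ₀ (z - x₀)) := by
  have hxS := h.mem_of_isUniqueMinimizer ha hx₀ hx
  rcases eq_or_ne z x with rfl | hzx
  · rfl
  have := hx z hzx
  rw [h.stepFunctional_eq hx₀ hxS, h.stepFunctional_eq hx₀ hz, EReal.coe_lt_coe_iff] at this
  exact this.le

end FinitePart

variable [NormedAddCommGroup X] [NormedSpace ℝ X]
  {Y : Type*} [NormedAddCommGroup Y] [NormedSpace ℝ Y]

theorem IsConjGradient.unique {f : X → EReal} {ξ : StrongDual ℝ X} {x x' : X}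
    (hx : IsConjGradient f ξ x) (hx' : IsConjGradient f ξ x') : x = x' :=
  (NormedSpace.inclusionInDoubleDualLi ℝ (E := X)).injective (hx.2.unique hx'.2)

theorem IsNoiseFreeIteration.unique {Θ : X → EReal} {D : Set X} {F : X → Y} {F' : X → X →L[ℝ] Y}
    {y : Y} {α : ℕ → ℝ} {ξ₀ : StrongDual ℝ X} {x x' : ℕ → X}
    (hx : IsNoiseFreeIteration Θ D F F' y α ξ₀ x) (hx' : IsNoiseFreeIteration Θ D F F' y α ξ₀ x') :
    x = x' := by
  funext n
  induction n with
  | zero => exact hx.init.unique hx'.init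
  | succ n ih =>
    have h := hx.step n
    rw [hx.init.unique hx'.init, ih] at h
    exact h.unique (hx'.step n)

/-- In a reflexive space the annihilator of the null space of `T` is the norm closure of the range
of the adjoint of `T`. -/
theorem exists_norm_sub_comp_lt {Z : Type*} [NormedAddCommGroup Z] [InnerProductSpace ℝ Z]
    (hX : Reflexive X) (T : X →L[ℝ] Z)
    {ξ : StrongDual ℝ X} (hξ : ξ ∈ nullAnnihilator T) {δ : ℝ} (hδ : 0 < δ) :
    ∃ w : Z, ‖ξ - (innerSL ℝ w).comp T‖ < δ := by
  let A : Z →ₗ[ℝ] StrongDual ℝ X :=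
    { toFun := fun w => (innerSL ℝ w).comp T
      map_add' := fun u w => by ext; simp
      map_smul' := fun r w => by ext; simp }
  by_contra! hcon
  have hnot : ξ ∉ closure (A.range : Set (StrongDual ℝ X)) := fun hmem => by
    obtain ⟨_, ⟨w, rfl⟩, hw⟩ := Metric.mem_closure_iff.1 hmem δ hδ
    rw [dist_eq_norm] at hw
    exact absurd hw (not_lt.2 (hcon w))
  obtain ⟨f, s, hs, hfs⟩ := geometric_hahn_banach_closed_point
    (A.range.convex.closure) isClosed_closure hnot
  -- A functional bounded above on a subspace vanishes there.
  have hzero : ∀ w, f (A w) = 0 := fun w => by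
    by_contra hne
    have := hs _ (subset_closure (⟨((s + 1) / f (A w)) • w, rfl⟩ :
      A (((s + 1) / f (A w)) • w) ∈ (A.range : Set (StrongDual ℝ X))))
    rw [map_smul, map_smul, smul_eq_mul, div_mul_cancel₀ _ hne] at this
    linarith
  have hs0 : 0 < s := by simpa using hs 0 (subset_closure A.range.zero_mem)
  obtain ⟨x, rfl⟩ := hX f
  simp only [NormedSpace.dual_def] at hzero hfs
  -- By reflexivity the separating functional is evaluation at `x`; testing with `w = T x` gives `‖T
  -- x‖² = 0`.
  have hTx : T x = 0 := by simpa [A] using hzero (T x)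
  linarith [hξ x hTx]

end IRGN

/-! ### One-sided derivatives and a perturbed contraction. -/

/-- Along a segment, the derivative hypothesis uses the remaining piece up to an endpoint as
direction; `d` is the length of that piece. -/
theorem hasDerivWithinAt_Ioi_of_tendsto_scaled {E : Type*} [NormedAddCommGroup E] [NormedSpace ℝ E]
    {G : ℝ → E} {t d : ℝ} {L : E} (hd : 0 < d)
    (h : Tendsto (fun s : ℝ => s⁻¹ • (G (t + s * d) - G t)) (𝓝[>] 0) (𝓝 (d • L))) :
    HasDerivWithinAt G L (Set.Ioi t) t := by
  rw [hasDerivWithinAt_iff_tendsto_slope' (by simp)]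
  have hlim : Tendsto (fun u : ℝ => (u - t) / d) (𝓝[>] t) (𝓝[>] 0) := by
    refine tendsto_nhdsWithin_iff.2 ⟨?_, ?_⟩
    · have : Tendsto (fun u : ℝ => (u - t) / d) (𝓝 t) (𝓝 ((t - t) / d)) :=
        Continuous.tendsto (by fun_prop) t
      rw [sub_self, zero_div] at this
      exact this.mono_left nhdsWithin_le_nhds
    · filter_upwards [self_mem_nhdsWithin] with u hu
      exact div_pos (sub_pos.2 hu) hd
  have h2 := (h.comp hlim).const_smul d⁻¹
  rw [inv_smul_smul₀ hd.ne'] at h2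
  refine h2.congr fun u => ?_
  simp only [Function.comp_apply, slope, vsub_eq_sub, div_mul_cancel₀ _ hd.ne', smul_smul,
    add_sub_cancel]
  congr 1
  rw [inv_div]
  field_simp

theorem tendsto_zero_of_le_half_add {b p : ℕ → ℝ} (hb : ∀ n, 0 ≤ b n)
    (hbp : ∀ n, b (n + 1) ≤ b n / 2 + p n) (hp : Tendsto p atTop (𝓝 0)) :
    Tendsto b atTop (𝓝 0) := by
  rw [Metric.tendsto_atTop]
  intro δ hδ
  obtain ⟨N, hN⟩ := eventually_atTop.1 (hp.eventually (gt_mem_nhds (show 0 < δ / 4 by positivity)))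
  -- Perturbations below `δ / 4`, halved at each step, accumulate to at most `δ / 2`.
  have key : ∀ k, b (N + k) ≤ b N * (1 / 2) ^ k + δ / 2 := by
    intro k
    induction k with
    | zero => simp; positivity
    | succ k ih =>
      have h1 := hbp (N + k)
      have h2 := hN (N + k) (Nat.le_add_right _ _)
      rw [← add_assoc, pow_succ]
      linarith
  have hpow : Tendsto (fun k : ℕ => b N * (1 / 2 : ℝ) ^ k) atTop (𝓝 0) := by
    simpa using (tendsto_pow_atTop_nhds_zero_of_lt_one (show (0 : ℝ) ≤ 1 / 2 by norm_num)
      (by norm_num)).const_mul (b N)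
  obtain ⟨M, hM⟩ := eventually_atTop.1
    (hpow.eventually (gt_mem_nhds (show 0 < δ / 2 by positivity)))
  refine ⟨N + M, fun n hn => ?_⟩
  obtain ⟨k, rfl⟩ := Nat.exists_eq_add_of_le (show N ≤ n by omega)
  rw [Real.dist_eq, sub_zero, abs_of_nonneg (hb _)]
  linarith [key k, hM k (by omega)]

namespace IRGN

theorem StepSizes.sqrt_le {α : ℕ → ℝ} {θ : ℝ} (h : StepSizes α θ) (n : ℕ) :
    √(α n) ≤ √θ * √(α (n + 1)) := by
  have := (div_le_iff₀ (h.pos (n + 1))).1 (h.le_theta n)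
  rw [← Real.sqrt_mul' _ (h.pos (n + 1)).le]
  exact Real.sqrt_le_sqrt this

variable {X : Type*} [NormedAddCommGroup X] [NormedSpace ℝ X]

/-! ### Estimates for one step and their propagation. -/

section OperatorCondition

variable {Y : Type*} [NormedAddCommGroup Y] [NormedSpace ℝ Y]
  {Θ : X → EReal} {γ : ℝ} {D : Set X} {F : X → Y} {F' : X → X →L[ℝ] Y}
  {y : Y} {xd : X} {ρ K₀ K₁ α₀ : ℝ}

namespace OperatorCondition

/-- Mean value inequality on the segment from `xd` to `z`, with right derivatives only; the
nonlinearity condition bounds the derivative of the remainder. -/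
theorem norm_linearization_le (h : OperatorCondition Θ γ D F F' y xd ρ K₀ K₁ α₀) {z : X}
    (hz : z ∈ Metric.ball xd ρ ∩ D) :
    ‖F z - F xd - F' xd (z - xd)‖ ≤ (K₀ + K₁) * ‖z - xd‖ * ‖F' xd (z - xd)‖ := by
  set e := z - xd with he
  set p : ℝ → X := fun t => xd + t • e with hp
  have hxd : xd ∈ Metric.ball xd ρ ∩ D := ⟨Metric.mem_ball_self h.rho_pos, h.sol_mem⟩
  have hpmem : ∀ t ∈ Set.Icc (0 : ℝ) 1, p t ∈ Metric.ball xd ρ ∩ D := fun t ht =>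
    ((convex_ball xd ρ).inter h.convex).add_smul_sub_mem hxd hz ht
  have hright : ∀ t ∈ Set.Ico (0 : ℝ) 1,
      HasDerivWithinAt (fun t => F (p t)) (F' (p t) e) (Set.Ioi t) t := by
    intro t ht
    have h1 := h.deriv (p t) (hpmem t ⟨ht.1, ht.2.le⟩) z hz
    have e1 : z - p t = (1 - t) • e := by simp only [hp, he]; module
    refine hasDerivWithinAt_Ioi_of_tendsto_scaled (sub_pos.2 ht.2) ?_
    rw [e1, map_smul] at h1
    refine h1.congr fun s => ?_
    have : p (t + s * (1 - t)) = p t + s • (1 - t) • e := by simp only [hp]; module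
    rw [this]
  -- Differentiating towards `xd` along the reversed path supplies continuity from the left.
  have hleft : ∀ t ∈ Set.Ioc (0 : ℝ) 1,
      HasDerivWithinAt (fun t => F (p (-t))) (-F' (p t) e) (Set.Ioi (-t)) (-t) := by
    intro t ht
    have h1 := h.deriv (p t) (hpmem t ⟨ht.1.le, ht.2⟩) xd hxd
    have e1 : xd - p t = t • (-e) := by simp only [hp]; module
    refine hasDerivWithinAt_Ioi_of_tendsto_scaled ht.1 ?_
    rw [e1, map_smul, map_neg] at h1
    refine h1.congr fun s => ?_
    have : p (-(-t + s * t)) = p t + s • t • (-e) := by simp only [hp]; module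
    rw [this, neg_neg]
  have hcont : ContinuousOn (fun t => F (p t)) (Set.Icc 0 1) := by
    intro t ht
    have hr : ContinuousWithinAt (fun t => F (p t)) (Set.Icc 0 1 ∩ Set.Ioi t) t := by
      rcases ht.2.eq_or_lt with rfl | h1
      · have : Set.Icc (0 : ℝ) 1 ∩ Set.Ioi 1 = ∅ := by ext; simp
        rw [this]
        exact continuousWithinAt_of_notMem_closure (by simp)
      · exact (hright t ⟨ht.1, h1⟩).continuousWithinAt.mono Set.inter_subset_right
    have hl : ContinuousWithinAt (fun t => F (p t)) (Set.Icc 0 1 ∩ Set.Iio t) t := by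
      rcases ht.1.eq_or_lt with rfl | h0
      · have : Set.Icc (0 : ℝ) 1 ∩ Set.Iio 0 = ∅ := by
          ext; simp; intros; linarith
        rw [this]
        exact continuousWithinAt_of_notMem_closure (by simp)
      · have hneg : ContinuousWithinAt (fun t : ℝ => -t) (Set.Iio t) t :=
          continuous_neg.continuousWithinAt
        have := (hleft t ⟨h0, ht.2⟩).continuousWithinAt.comp hneg
          (fun u hu => by simpa using hu)
        simp only [Function.comp_def, neg_neg] at this
        exact this.mono Set.inter_subset_right
    have hs : ContinuousWithinAt (fun t => F (p t)) {t} t :=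
      continuousWithinAt_singleton
    refine ((hl.union hr).union hs).mono fun u hu => ?_
    rcases lt_trichotomy u t with h1 | h1 | h1
    · exact Or.inl (Or.inl ⟨hu, h1⟩)
    · exact Or.inr h1
    · exact Or.inl (Or.inr ⟨hu, h1⟩)
  have hK := h.K₀_nonneg
  have hK' := h.K₁_nonneg
  have main := norm_image_sub_le_of_norm_deriv_right_le_segment
    (f := fun t => F (p t) - t • F' xd e) (f' := fun t => F' (p t) e - F' xd e) (a := 0) (b := 1)
    (C := (K₀ + K₁) * ‖e‖ * ‖F' xd e‖) (hcont.sub (by fun_prop))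
    (fun t ht => ((hright t ht).Ici_of_Ioi.sub
      (by simpa using ((hasDerivAt_id t).smul_const (F' xd e)).hasDerivWithinAt)))
    (fun t ht => by
      have h1 := h.nonlinearity xd hxd (p t) (hpmem t ⟨ht.1, ht.2.le⟩) e
      have e1 : p t - xd = t • e := by simp [hp]
      rw [e1, map_smul, norm_smul, norm_smul, Real.norm_of_nonneg ht.1] at h1
      have h2 : t * (((K₀ + K₁) * ‖e‖ * ‖F' xd e‖)) ≤ 1 * ((K₀ + K₁) * ‖e‖ * ‖F' xd e‖) := by
        gcongr
        exact ht.2.le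
      rw [_root_.sub_apply] at h1
      linarith)
    1 (by simp)
  have e0 : p 0 = xd := by simp [hp]
  have e1 : p 1 = z := by simp [hp, he]
  simp only [e0, e1, one_smul, zero_smul, sub_zero, mul_one] at main
  rwa [sub_right_comm]

/-- The residual `r` at `xd` consists of a linearization error and a derivative difference, each at
most `(K₀ + K₁) ‖e‖ B`; hence `‖r‖ ≤ μ B`. In the application `p = v (x' - xd)` and `V = ‖v‖`. -/
theorem step_bounds (h : OperatorCondition Θ γ D F F' y xd ρ K₀ K₁ α₀) (hγ : 0 < γ)
    {x x' : X} {a V p μ : ℝ} (hx : x ∈ Metric.ball xd ρ ∩ D) (ha : 0 < a) (hV : 0 ≤ V)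
    (hKV : 4 * γ ^ 2 * ((K₀ + K₁) * V) ≤ μ) (hμ : μ ≤ 1) (hxV : ‖x - xd‖ ≤ 2 * γ ^ 2 * V)
    (hBV : μ * ‖F' xd (x - xd)‖ ≤ γ * V * √a) (hpV : p ≤ V * ‖x' - xd‖)
    (hstep : ‖y - F x - F' x (x' - x)‖ ^ 2 + a * ((γ ^ 2)⁻¹ * ‖x' - xd‖ ^ 2)
      ≤ ‖y - F x - F' x (xd - x)‖ ^ 2 + a * p) :
    ‖x' - xd‖ ≤ 2 * γ ^ 2 * V ∧
      ‖F' xd (x' - xd)‖ ≤ 5 * μ * ‖F' xd (x - xd)‖ + 2 * (√a * √|p|) ∧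
      a * ((γ ^ 2)⁻¹ * ‖x' - xd‖ ^ 2) ≤ (μ * ‖F' xd (x - xd)‖) ^ 2 + a * |p| := by
  have hxd : xd ∈ Metric.ball xd ρ ∩ D := ⟨Metric.mem_ball_self h.rho_pos, h.sol_mem⟩
  have hK := h.K₀_nonneg
  have hK' := h.K₁_nonneg
  have hμ0 : 0 ≤ μ := le_trans (by positivity) hKV
  have hnl := h.nonlinearity xd hxd x hx
  have hlin := h.norm_linearization_le hx
  set e := x - xd with he
  set e' := x' - xd with he'
  set B := ‖F' xd e‖ with hB
  set r := y - F x - F' x (xd - x) with hr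
  have hr' : r = -(F x - F xd - F' xd e) + (F' x - F' xd) e := by
    rw [hr, ← h.sol_eq, _root_.sub_apply, he]
    simp only [map_sub]
    abel
  have hs' : y - F x - F' x (x' - x) = r - F' x e' := by
    rw [hr, he']
    simp only [map_sub]
    abel
  have hrB : ‖r‖ ≤ μ * B := by
    have h1 : ‖r‖ ≤ ‖F x - F xd - F' xd e‖ + ‖(F' x - F' xd) e‖ := by
      rw [hr']
      exact (norm_add_le _ _).trans (by rw [norm_neg])
    have h2 : 2 * (K₀ + K₁) * ‖e‖ * B ≤ 2 * (K₀ + K₁) * (2 * γ ^ 2 * V) * B := by gcongr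
    have h3 : 4 * γ ^ 2 * ((K₀ + K₁) * V) * B ≤ μ * B := by gcongr
    linarith [hnl e]
  rw [hs'] at hstep
  have hr2 : ‖r‖ ^ 2 ≤ (μ * B) ^ 2 := by gcongr
  have hsa : √a ^ 2 = a := Real.sq_sqrt ha.le
  have he'V : ‖e'‖ ≤ 2 * γ ^ 2 * V := by
    have h1 : (μ * B) ^ 2 ≤ (γ * V * √a) ^ 2 := by gcongr
    have h2 : a * ((γ ^ 2)⁻¹ * ‖e'‖ ^ 2) ≤ a * (γ ^ 2 * V ^ 2 + V * ‖e'‖) := by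
      have h3 : a * p ≤ a * (V * ‖e'‖) := by gcongr
      rw [mul_pow (γ * V), hsa] at h1
      nlinarith [sq_nonneg ‖r - F' x e'‖]
    have h3 := (inv_mul_le_iff₀ (by positivity)).1 (le_of_mul_le_mul_left h2 ha)
    by_contra! hcon
    have hW : 0 ≤ γ ^ 2 * V := by positivity
    -- A quadratic inequality `t² ≤ W² + W t`, incompatible with `t > 2 W`.
    have h4 : ‖e'‖ ^ 2 ≤ (γ ^ 2 * V) ^ 2 + (γ ^ 2 * V) * ‖e'‖ := by linarith
    rw [mul_assoc] at hcon
    generalize γ ^ 2 * V = W at hcon hW h4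
    nlinarith
  refine ⟨he'V, ?_, ?_⟩
  · have h1 : ‖r - F' x e'‖ ≤ μ * B + √a * √|p| := by
      apply le_of_sq_le_sq _ (by positivity)
      have h2 : a * p ≤ a * |p| := by gcongr; exact le_abs_self p
      have h3 : (√a * √|p|) ^ 2 = a * |p| := by
        rw [mul_pow, hsa, Real.sq_sqrt (abs_nonneg p)]
      have h4 : 0 ≤ (μ * B) * (√a * √|p|) := by positivity
      have h5 : 0 ≤ a * ((γ ^ 2)⁻¹ * ‖e'‖ ^ 2) := by positivity
      nlinarith
    have h2 : ‖F' x e'‖ ≤ ‖r‖ + ‖r - F' x e'‖ := by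
      have := norm_sub_le r (r - F' x e')
      simpa using this
    have h3 : ‖F' xd e'‖ ≤ ‖F' x e'‖ + ‖(F' x - F' xd) e'‖ := by
      have := norm_sub_le (F' x e') ((F' x - F' xd) e')
      simpa using this
    have h4 : K₀ * ‖e‖ * ‖F' xd e'‖ ≤ K₀ * (2 * γ ^ 2 * V) * ‖F' xd e'‖ := by gcongr
    have h5 : K₁ * B * ‖e'‖ ≤ K₁ * B * (2 * γ ^ 2 * V) := by gcongr
    have h6 : 2 * γ ^ 2 * (K₀ * V) ≤ μ / 2 := by
      have : 0 ≤ γ ^ 2 * (K₁ * V) := by positivity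
      linarith
    have h7 : 2 * γ ^ 2 * (K₁ * V) ≤ μ / 2 := by
      have : 0 ≤ γ ^ 2 * (K₀ * V) := by positivity
      linarith
    have h8 := mul_le_mul_of_nonneg_right h6 (norm_nonneg (F' xd e'))
    have h9 := mul_le_mul_of_nonneg_right h7 (norm_nonneg (F' xd e))
    -- Half of `‖F' xd e'‖` is absorbed on the left. The remaining coefficient of `B` is `2 μ + μ /
    -- 2`, and doubling gives `5 μ`.
    have h10 : μ * ‖F' xd e'‖ ≤ 1 * ‖F' xd e'‖ := by gcongr
    linarith [hnl e']
  · have h2 : a * p ≤ a * |p| := by gcongr; exact le_abs_self p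
    linarith [sq_nonneg ‖r - F' x e'‖]

variable {α : ℕ → ℝ} {θ : ℝ} {v : StrongDual ℝ X} {x : ℕ → X}

theorem iterate_bounds (h : OperatorCondition Θ γ D F F' y xd ρ K₀ K₁ (α 0)) (hγ : 0 < γ)
    (hθ : 1 < θ) (hα : StepSizes α θ) (hρ : 2 * γ ^ 2 * ‖v‖ < ρ)
    (hK : (K₀ + K₁) * ‖v‖ ≤ 1 / (40 * γ ^ 2 * √θ)) (hxD : ∀ n, x n ∈ D)
    (hinit : ‖x 0 - xd‖ ≤ γ ^ 2 * ‖v‖)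
    (hstep : ∀ n, ‖y - F (x n) - F' (x n) (x (n + 1) - x n)‖ ^ 2
        + α n * ((γ ^ 2)⁻¹ * ‖x (n + 1) - xd‖ ^ 2)
      ≤ ‖y - F (x n) - F' (x n) (xd - x n)‖ ^ 2 + α n * v (x (n + 1) - xd)) (n : ℕ) :
    (‖x n - xd‖ ≤ 2 * γ ^ 2 * ‖v‖ ∧ ‖F' xd (x n - xd)‖ ≤ 8 * γ * √θ * √(α n) * ‖v‖) ∧
      ‖F' xd (x (n + 1) - xd)‖ ≤ 5 * (1 / (10 * √θ)) * ‖F' xd (x n - xd)‖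
        + 2 * (√(α n) * √|v (x (n + 1) - xd)|) ∧
      α n * ((γ ^ 2)⁻¹ * ‖x (n + 1) - xd‖ ^ 2)
        ≤ (1 / (10 * √θ) * ‖F' xd (x n - xd)‖) ^ 2 + α n * |v (x (n + 1) - xd)| := by
  have hsθ : 0 < √θ := Real.sqrt_pos.2 (by linarith)
  have hsθ1 : 1 ≤ √θ := Real.one_le_sqrt.2 hθ.le
  set V := ‖v‖ with hV
  have hV0 : 0 ≤ V := norm_nonneg v
  set T := F' xd with hT
  set μ := 1 / (10 * √θ) with hμ
  have hμ0 : 0 < μ := by positivity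
  have hμ1 : μ ≤ 1 := by
    rw [hμ, div_le_one (by positivity)]
    linarith
  have hμθ : √θ * (10 * μ) = 1 := by rw [hμ]; field_simp
  have hKμ : 4 * γ ^ 2 * ((K₀ + K₁) * V) ≤ μ := by
    calc 4 * γ ^ 2 * ((K₀ + K₁) * V) ≤ 4 * γ ^ 2 * (1 / (40 * γ ^ 2 * √θ)) := by gcongr
      _ = μ := by rw [hμ]; field_simp; norm_num
  have hsα : ∀ n, 0 < √(α n) := fun n => Real.sqrt_pos.2 (hα.pos n)
  have hbounds : ∀ n, ‖x n - xd‖ ≤ 2 * γ ^ 2 * V →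
      ‖T (x n - xd)‖ ≤ 8 * γ * √θ * √(α n) * V →
      ‖x (n + 1) - xd‖ ≤ 2 * γ ^ 2 * V ∧
      ‖T (x (n + 1) - xd)‖
        ≤ 5 * μ * ‖T (x n - xd)‖ + 2 * (√(α n) * √|v (x (n + 1) - xd)|) ∧
      α n * ((γ ^ 2)⁻¹ * ‖x (n + 1) - xd‖ ^ 2)
        ≤ (μ * ‖T (x n - xd)‖) ^ 2 + α n * |v (x (n + 1) - xd)| := by
    intro n h1 h2
    refine h.step_bounds hγ
      ⟨by rw [Metric.mem_ball, dist_eq_norm]; exact h1.trans_lt hρ, hxD n⟩ (hα.pos n)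
      hV0 hKμ hμ1 h1 ?_ ((le_abs_self _).trans (v.le_opNorm _)) ?_
    · calc μ * ‖T (x n - xd)‖ ≤ μ * (8 * γ * √θ * √(α n) * V) := by gcongr
        _ = (√θ * (10 * μ)) * (8 / 10) * (γ * V * √(α n)) := by ring
        _ ≤ γ * V * √(α n) := by
          rw [hμθ]
          have : 0 ≤ γ * V * √(α n) := by positivity
          linarith
    · exact hstep n
  have hinv : ∀ n, ‖x n - xd‖ ≤ 2 * γ ^ 2 * V ∧ ‖T (x n - xd)‖ ≤ 8 * γ * √θ * √(α n) * V := by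
    intro n
    induction n with
    | zero =>
      refine ⟨hinit.trans ?_, ?_⟩
      · have : 0 ≤ γ ^ 2 * V := by positivity
        linarith
      · calc ‖T (x 0 - xd)‖ ≤ ‖T‖ * ‖x 0 - xd‖ := T.le_opNorm _
          _ ≤ √(α 0) / γ * (γ ^ 2 * V) := by
            gcongr
            exact h.scaled
          _ = 1 * (γ * √(α 0) * V) := by field_simp
          _ ≤ (8 * √θ) * (γ * √(α 0) * V) := by gcongr; linarith
          _ = 8 * γ * √θ * √(α 0) * V := by ring
    | succ n ih =>
      obtain ⟨h1, h2, -⟩ := hbounds n ih.1 ih.2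
      refine ⟨h1, ?_⟩
      have h3 : √|v (x (n + 1) - xd)| ≤ 2 * γ * V := by
        rw [Real.sqrt_le_left (by positivity)]
        calc |v (x (n + 1) - xd)| ≤ V * ‖x (n + 1) - xd‖ := v.le_opNorm _
          _ ≤ V * (2 * γ ^ 2 * V) := by gcongr
          _ ≤ (2 * γ * V) ^ 2 := by nlinarith [mul_nonneg (sq_nonneg γ) (sq_nonneg V)]
      -- Since `10 μ √θ = 1`, the inherited and the driving term contribute `4 γ √(α n) V` each;
      -- passing to `α (n + 1)` costs the factor `√θ`.
      calc ‖T (x (n + 1) - xd)‖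
          ≤ 5 * μ * ‖T (x n - xd)‖ + 2 * (√(α n) * √|v (x (n + 1) - xd)|) := h2
        _ ≤ 5 * μ * (8 * γ * √θ * √(α n) * V) + 2 * (√(α n) * (2 * γ * V)) := by
          gcongr
          exact ih.2
        _ = (√θ * (10 * μ)) * (4 * γ * √(α n) * V) + 4 * γ * √(α n) * V := by ring
        _ = 8 * γ * √(α n) * V := by rw [hμθ]; ring
        _ ≤ 8 * γ * (√θ * √(α (n + 1))) * V := by
          gcongr
          exact hα.sqrt_le n
        _ = 8 * γ * √θ * √(α (n + 1)) * V := by ring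
  exact ⟨hinv n, (hbounds n (hinv n).1 (hinv n).2).2⟩

end OperatorCondition

end OperatorCondition

/-! ### Convergence of the iterates. -/

/-- In a reflexive space, functionals annihilating the null space of `T` tend to zero along bounded
sequences on which `T` tends to zero. -/
theorem tendsto_zero_of_mem_nullAnnihilator {Y : Type*} [NormedAddCommGroup Y]
    [InnerProductSpace ℝ Y] (hX : Reflexive X) {T : X →L[ℝ] Y} {ξ : StrongDual ℝ X}
    (hξ : ξ ∈ nullAnnihilator T) {e : ℕ → X} {M : ℝ} (hM : ∀ n, ‖e n‖ ≤ M)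
    (he : Tendsto (fun n => ‖T (e n)‖) atTop (𝓝 0)) : Tendsto (fun n => ξ (e n)) atTop (𝓝 0) := by
  have hM0 : 0 ≤ M := (norm_nonneg _).trans (hM 0)
  rw [Metric.tendsto_atTop]
  intro δ hδ
  obtain ⟨w, hw⟩ := exists_norm_sub_comp_lt hX T hξ (show 0 < δ / (2 * (M + 1)) by positivity)
  have hlim : Tendsto (fun n => ‖w‖ * ‖T (e n)‖) atTop (𝓝 0) := by simpa using he.const_mul ‖w‖
  obtain ⟨N, hN⟩ := eventually_atTop.1
    (hlim.eventually (gt_mem_nhds (show 0 < δ / 2 by positivity)))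
  refine ⟨N, fun n hn => ?_⟩
  rw [dist_zero_right]
  have e1 : ξ (e n) = (ξ - (innerSL ℝ w).comp T) (e n) + inner ℝ w (T (e n)) := by simp
  have h1 := (ξ - (innerSL ℝ w).comp T).le_opNorm (e n)
  have h2 : ‖ξ - (innerSL ℝ w).comp T‖ * ‖e n‖ ≤ δ / (2 * (M + 1)) * (M + 1) := by
    gcongr
    linarith [hM n]
  have h3 : δ / (2 * (M + 1)) * (M + 1) = δ / 2 := by field_simp
  have h4 := norm_inner_le_norm (𝕜 := ℝ) w (T (e n))
  rw [e1]
  linarith [norm_add_le ((ξ - (innerSL ℝ w).comp T) (e n)) (inner ℝ w (T (e n))), hN n hn]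

namespace OperatorCondition

variable {Y : Type*} [NormedAddCommGroup Y] [InnerProductSpace ℝ Y]
  {Θ : X → EReal} {γ : ℝ} {D : Set X} {F : X → Y} {F' : X → X →L[ℝ] Y}
  {y : Y} {xd : X} {ρ K₀ K₁ θ : ℝ} {α : ℕ → ℝ} {v : StrongDual ℝ X} {x : ℕ → X}

/-- A bootstrap: the bound `O(√α n)` gives `v (e n) → 0`. The ratios `‖T (e n)‖ / √α n` then halve
at each step up to a null sequence, as `5 μ √θ = 1/2`, and the energy estimate controls `‖e n‖`. -/
theorem iterate_tendsto (h : OperatorCondition Θ γ D F F' y xd ρ K₀ K₁ (α 0)) (hγ : 0 < γ)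
    (hθ : 1 < θ) (hα : StepSizes α θ) (hρ : 2 * γ ^ 2 * ‖v‖ < ρ)
    (hK : (K₀ + K₁) * ‖v‖ ≤ 1 / (40 * γ ^ 2 * √θ)) (hxD : ∀ n, x n ∈ D)
    (hinit : ‖x 0 - xd‖ ≤ γ ^ 2 * ‖v‖)
    (hstep : ∀ n, ‖y - F (x n) - F' (x n) (x (n + 1) - x n)‖ ^ 2
        + α n * ((γ ^ 2)⁻¹ * ‖x (n + 1) - xd‖ ^ 2)
      ≤ ‖y - F (x n) - F' (x n) (xd - x n)‖ ^ 2 + α n * v (x (n + 1) - xd))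
    (hX : Reflexive X) (hv : v ∈ nullAnnihilator (F' xd)) :
    Tendsto (fun n => ‖x n - xd‖) atTop (𝓝 0) ∧
      Tendsto (fun n => ‖F' xd (x n - xd)‖ / √(α n)) atTop (𝓝 0) := by
  have hsθ : 0 < √θ := Real.sqrt_pos.2 (by linarith)
  have hsα : ∀ n, 0 < √(α n) := fun n => Real.sqrt_pos.2 (hα.pos n)
  have hall := h.iterate_bounds hγ hθ hα hρ hK hxD hinit hstep
  set T := F' xd with hT
  set μ := 1 / (10 * √θ) with hμ
  have hμθ : √θ * (10 * μ) = 1 := by rw [hμ]; field_simp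
  have hsα0 : Tendsto (fun n => √(α n)) atTop (𝓝 0) := by
    simpa using hα.tendsto_zero.sqrt
  have hT0 : Tendsto (fun n => ‖T (x n - xd)‖) atTop (𝓝 0) := by
    refine squeeze_zero (fun _ => norm_nonneg _) (fun n => (hall n).1.2) ?_
    simpa using (hsα0.const_mul (8 * γ * √θ)).mul_const ‖v‖
  have hv0 : Tendsto (fun n => |v (x (n + 1) - xd)|) atTop (𝓝 0) := by
    have := (tendsto_zero_of_mem_nullAnnihilator hX hv (fun n => (hall n).1.1) hT0).abs
    rw [abs_zero] at this
    exact this.comp (tendsto_add_atTop_nat 1)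
  have hratio : Tendsto (fun n => ‖T (x n - xd)‖ / √(α n)) atTop (𝓝 0) := by
    refine tendsto_zero_of_le_half_add (p := fun n => √θ * (2 * √|v (x (n + 1) - xd)|))
      (fun n => by positivity) (fun n => ?_) ?_
    · have h2 := (hall n).2.1
      rw [div_le_iff₀ (hsα _)]
      have h3 : ‖T (x n - xd)‖ / √(α n) * √(α n) = ‖T (x n - xd)‖ := div_mul_cancel₀ _ (hsα n).ne'
      calc ‖T (x (n + 1) - xd)‖
          ≤ (5 * μ * (‖T (x n - xd)‖ / √(α n)) + 2 * √|v (x (n + 1) - xd)|) * √(α n) := by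
            rw [add_mul, mul_assoc (5 * μ), h3]
            linarith
        _ ≤ (5 * μ * (‖T (x n - xd)‖ / √(α n)) + 2 * √|v (x (n + 1) - xd)|)
            * (√θ * √(α (n + 1))) := by
          gcongr
          exact hα.sqrt_le n
        _ = ((√θ * (10 * μ)) * (‖T (x n - xd)‖ / √(α n)) / 2
            + √θ * (2 * √|v (x (n + 1) - xd)|)) * √(α (n + 1)) := by ring
        _ = _ := by rw [hμθ, one_mul]
    · simpa using (hv0.sqrt.const_mul 2).const_mul √θ
  refine ⟨?_, hratio⟩
  rw [← tendsto_add_atTop_iff_nat 1]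
  have hlim : Tendsto (fun n => √(γ ^ 2 * ((μ * (‖T (x n - xd)‖ / √(α n))) ^ 2
      + |v (x (n + 1) - xd)|))) atTop (𝓝 0) := by
    simpa using ((((hratio.const_mul μ).pow 2).add hv0).const_mul (γ ^ 2)).sqrt
  refine squeeze_zero (fun _ => norm_nonneg _) (fun n => Real.le_sqrt_of_sq_le ?_) hlim
  have h3 := (hall n).2.2
  rw [← inv_mul_le_iff₀ (by positivity)]
  refine le_of_mul_le_mul_left (h3.trans (le_of_eq ?_)) (hα.pos n)
  rw [mul_div_assoc', div_pow, Real.sq_sqrt (hα.pos n).le]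
  field_simp [(hα.pos n).ne']

end OperatorCondition

/-! ### Well-definedness of the iteration. -/

section WellDefined

variable {Y : Type*} [NormedAddCommGroup Y] [NormedSpace ℝ Y] {Θ : X → EReal} {γ c : ℝ} {D S : Set X}
  {g : X → ℝ} {F : X → Y} {F' : X → X →L[ℝ] Y} {y : Y} {α : ℕ → ℝ}

theorem FinitePart.exists_isNoiseFreeIteration [CompleteSpace X]
    (h : FinitePart (IRGN.restricted Θ D) S g) (hc : 0 < c)
    (hg : UniformConvexOn S (fun r => c * r ^ 2) g) (hcl : ∀ M, IsClosed {x | x ∈ S ∧ g x ≤ M})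
    (hS : S.Nonempty) (hα : ∀ n, 0 < α n) (ξ₀ : StrongDual ℝ X) :
    ∃ x, IsNoiseFreeIteration Θ D F F' y α ξ₀ x ∧ (∀ n, x n ∈ S) ∧
      ∀ z ∈ S, g (x 0) + ξ₀ (z - x 0) + c * ‖z - x 0‖ ^ 2 ≤ g z := by
  obtain ⟨x₀, hx₀S, hx₀⟩ := (hg.add_convexOn
    (((-ξ₀ : StrongDual ℝ X) : X →ₗ[ℝ] ℝ).convexOn hg.1)).exists_forall_growth_le hc hS
    (isClosed_sublevel_add_continuous hcl (-ξ₀).continuous)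
  have hgr : ∀ z ∈ S, g x₀ + ξ₀ (z - x₀) + c * ‖z - x₀‖ ^ 2 ≤ g z := fun z hz => by
    have := hx₀ z hz
    simp only [map_sub, ContinuousLinearMap.coe_coe, _root_.neg_apply] at this ⊢
    linarith
  choose next hnext using fun n u =>
    h.exists_isUniqueMinimizer (F := F) (F' := F') (y := y) (ξ₀ := ξ₀) (xn := u) hc hg hcl (hα n) hx₀S
  obtain ⟨x, rfl, hx⟩ : ∃ x : ℕ → X, x 0 = x₀ ∧ ∀ n, x (n + 1) = next n (x n) :=
    ⟨fun n => Nat.rec x₀ next n, rfl, fun _ => rfl⟩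
  refine ⟨x, ⟨h.isConjGradient hc hx₀S hgr, fun n => hx n ▸ hnext n (x n)⟩, fun n => ?_, hgr⟩
  cases n with
  | zero => exact hx₀S
  | succ n => exact hx n ▸ h.mem_of_isUniqueMinimizer (hα n) hx₀S (hnext n (x n))

/-- The Bregman bound with constant `γ` makes the restriction of `Θ` to a closed convex set uniformly
convex with constant `γ⁻²`. -/
theorem exists_finitePart_restricted [CompleteSpace X] (hγ : 0 < γ) (hproper : Proper Θ)
    (hlsc : LowerSemicontinuous Θ) (hconv : TwoConvex Θ) (hbreg : BregmanBound Θ γ)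
    (hD : IsClosed D) (hDc : Convex ℝ D) :
    ∃ S g, FinitePart (IRGN.restricted Θ D) S g ∧ S ⊆ D ∧
      UniformConvexOn S (fun r => (γ ^ 2)⁻¹ * r ^ 2) g ∧ ∀ M, IsClosed {x | x ∈ S ∧ g x ≤ M} := by
  have hfin := FinitePart.of_ne_bot hproper.1
  have hcl := hfin.isClosed_sublevel hlsc
  obtain ⟨c₀, hc₀, hunif⟩ := hfin.uniformConvexOn hconv
  -- The unspecified constant `c₀` is exchanged for `γ⁻²` before restricting to `D`, where new
  -- subgradients may appear.
  have hunif' := hunif.of_subgradient_growth hc₀ (by positivity) hcl (hfin.subgradient_growth hγ hbreg)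
  refine ⟨_, _, hfin.restricted D, Set.inter_subset_right,
    ⟨hunif'.1.inter hDc, fun x hx z hz => hunif'.2 hx.1 hz.1⟩, fun M => ?_⟩
  convert (hcl M).inter hD using 1
  ext x
  simp only [Set.mem_inter_iff, Set.mem_ofPred_eq]
  tauto

end WellDefined

end IRGN

/-! ### The convergence theorem. -/

theorem theorem5p1 (γ θ : ℝ) (hγ : 0 < γ) (hθ : 1 < θ) :
    ∃ ε : ℝ, 0 < ε ∧
      ∀ (X : Type u) [NormedAddCommGroup X] [NormedSpace ℝ X] [CompleteSpace X]
        (Y : Type v) [NormedAddCommGroup Y] [InnerProductSpace ℝ Y] [CompleteSpace Y]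
        (Θ : X → EReal) (D : Set X) (F : X → Y) (F' : X → X →L[ℝ] Y)
        (y : Y) (xd : X) (ρ K₀ K₁ : ℝ) (α : ℕ → ℝ) (ξ₀ ξd : StrongDual ℝ X),
        IRGN.Reflexive X →
        IRGN.Proper Θ → LowerSemicontinuous Θ → IRGN.TwoConvex Θ → IRGN.BregmanBound Θ γ →
        IRGN.StepSizes α θ →
        IRGN.OperatorCondition Θ γ D F F' y xd ρ K₀ K₁ (α 0) →
        ξd ∈ IRGN.subdiff (IRGN.restricted Θ D) xd →
        ‖ξ₀ - ξd‖ = Metric.infDist ξ₀ (IRGN.subdiff (IRGN.restricted Θ D) xd) →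
        ξ₀ - ξd ∈ IRGN.nullAnnihilator (F' xd) →
        2 * γ ^ 2 * ‖ξ₀ - ξd‖ < ρ →
        (K₀ + K₁) * ‖ξ₀ - ξd‖ ≤ ε →
        ∃ x : ℕ → X,
          IRGN.IsNoiseFreeIteration Θ D F F' y α ξ₀ x ∧
          (∀ x' : ℕ → X, IRGN.IsNoiseFreeIteration Θ D F F' y α ξ₀ x' → x' = x) ∧
          (∀ n, x n ∈ Metric.ball xd ρ ∩ D) ∧
          Tendsto (fun n => ‖x n - xd‖) atTop (𝓝 0) ∧
          Tendsto (fun n => ‖F' xd (x n - xd)‖ / Real.sqrt (α n)) atTop (𝓝 0) := by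
  -- Chosen so that `4 γ² ε = 1 / (10 √θ)`, the `μ` of the step estimates.
  refine ⟨1 / (40 * γ ^ 2 * √θ), by positivity, ?_⟩
  intro X _ _ _ Y _ _ _ Θ D F F' y xd ρ K₀ K₁ α ξ₀ ξd hX hproper hlsc hconv hbreg hα hop hξd _ hnull
    hρ hK
  obtain ⟨S, g, hfin, hSD, hunif, hcl⟩ :=
    IRGN.exists_finitePart_restricted hγ hproper hlsc hconv hbreg hop.closed hop.convex
  have hc : 0 < (γ ^ 2)⁻¹ := by positivity
  obtain ⟨hxdS, hξd⟩ := hfin.mem_subdiff_iff.1 hξd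
  obtain ⟨x, hiter, hxS, hgr₀⟩ := hfin.exists_isNoiseFreeIteration (F := F) (F' := F') (y := y) hc
    hunif hcl ⟨xd, hxdS⟩ hα.pos ξ₀
  have hgrd : ∀ z ∈ S, g xd + ξd (z - xd) + (γ ^ 2)⁻¹ * ‖z - xd‖ ^ 2 ≤ g z := fun z hz => by
    have h1 := (hunif.add_convexOn (((-ξd : StrongDual ℝ X) : X →ₗ[ℝ] ℝ).convexOn
      hunif.1)).quadratic_growth hxdS (fun z hz => by
        have := hξd z hz
        simp only [map_sub, ContinuousLinearMap.coe_coe, _root_.neg_apply] at this ⊢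
        linarith) hz
    simp only [map_sub, ContinuousLinearMap.coe_coe, _root_.neg_apply] at h1 ⊢
    linarith
  -- Minimality against `xd`, combined with growth of `g - ξd` at `xd`: the values of `g` cancel and
  -- only `ξ₀ - ξd` remains.
  have hstep : ∀ n, ‖y - F (x n) - F' (x n) (x (n + 1) - x n)‖ ^ 2
        + α n * ((γ ^ 2)⁻¹ * ‖x (n + 1) - xd‖ ^ 2)
      ≤ ‖y - F (x n) - F' (x n) (xd - x n)‖ ^ 2 + α n * (ξ₀ - ξd) (x (n + 1) - xd) := fun n => by
    have h3 := hfin.le_of_isUniqueMinimizer (hα.pos n) (hxS 0) (hiter.step n) hxdS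
    have h4 := mul_le_mul_of_nonneg_left (hgrd _ (hxS (n + 1))) (hα.pos n).le
    simp only [_root_.sub_apply, map_sub] at h3 h4 ⊢
    linarith
  -- Adding the growth inequalities at `x 0` and at `xd` gives strong monotonicity of the
  -- subgradients; one of the two squares is discarded.
  have hinit : ‖x 0 - xd‖ ≤ γ ^ 2 * ‖ξ₀ - ξd‖ := by
    have h1 := hgr₀ xd hxdS
    have h2 := hgrd (x 0) (hxS 0)
    have h3 := (le_abs_self _).trans ((ξ₀ - ξd).le_opNorm (x 0 - xd))
    rw [norm_sub_rev] at h1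
    have h4 : (γ ^ 2)⁻¹ * ‖x 0 - xd‖ ^ 2 ≤ ‖ξ₀ - ξd‖ * ‖x 0 - xd‖ := by
      have : 0 ≤ (γ ^ 2)⁻¹ * ‖x 0 - xd‖ ^ 2 := by positivity
      simp only [_root_.sub_apply, map_sub] at h1 h2 h3
      linarith
    rw [inv_mul_le_iff₀ (by positivity)] at h4
    rcases (norm_nonneg (x 0 - xd)).eq_or_lt with h0 | h0
    · rw [← h0]; positivity
    · exact le_of_mul_le_mul_right (by linarith) h0
  have hxD : ∀ n, x n ∈ D := fun n => hSD (hxS n)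
  obtain ⟨hlim, hlimT⟩ := hop.iterate_tendsto hγ hθ hα hρ hK hxD hinit hstep hX hnull
  refine ⟨x, hiter, fun x' hx' => hx'.unique hiter, fun n => ⟨?_, hxD n⟩, hlim, hlimT⟩
  rw [Metric.mem_ball, dist_eq_norm]
  exact (hop.iterate_bounds hγ hθ hα hρ hK hxD hinit hstep n).1.1.trans_lt hρ
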